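/- Let $S$ be a locally compact Hausdorff topological $*$-semigroup with identity (jointly continuous multiplication, continuous involution with $(xy)^*=y^*x^*$, $x^{**}=x$). Let $M(S)$ be the Banach space of bounded regular complex Borel measures on $S$ with $\|\mu\|=|\mu|(S)$, and let $L(S)$ be the set of all $\mu\in M(S)$ for which $x\mapsto|\mu|*\delta_x$ and $x\mapsto\delta_x*|\mu|$ are continuous from $S$ to $M(S)$ with its weak topology $\sigma(M(S),M(S)^*)$. Assume that $S$ is *foundation*, i.e. $\bigcup_{\mu\in L(S)}\operatorname{supp}\mu$ is dense in $S$. Let $\Sigma=\Sigma(S)$ be the family of all weakly continuous $*$-representations $\pi:S\to B(H_\pi)$ on Hilbert spaces with $\|\pi(x)\|\le1$ for all $x\in S$ (the underlying sets of the Hilbert spaces are taken in a fixed universe containing $S$), and assume that $\Sigma$ separates the points of $S$. For $\pi\in\Sigma$ and $\mu\in M(S)$ let $\tilde\pi(\mu)\in B(H_\pi)$ be the operator with $\langle\tilde\pi(\mu)\xi,\eta\rangle=\int_S\langle\pi(x)\xi,\eta\rangle\,d\mu(x)$ for $\xi,\eta\in H_\pi$. Let $C^*(S)$ be the completion of $L(S)/\{\mu:\|\mu\|_\Sigma=0\}$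 in the norm $\|\mu\|_\Sigma=\sup_{\pi\in\Sigma}\|\tilde\pi(\mu)\|$; each $\tilde\pi$ extends uniquely by continuity to a $*$-representation of $C^*(S)$, again denoted $\tilde\pi$. Let $\pi_u=\bigoplus_\pi\pi$ on $H_u=\bigoplus_\pi H_\pi$, where $\pi$ runs either (a) over all irreducible elements of $\Sigma$ (nonzero representations whose only closed invariant subspaces are $0$ and $H_\pi$), or (b) over all cyclic elements of $\Sigma$. Let $W^*(S)\subseteq B(H_u)$ be the closure of $\tilde\pi_u(C^*(S))$ in the weak operator topology. Then, in case (a) as well as in case (b), $$\pi_u(S)''=\tilde\pi_u(L(S))''=\tilde\pi_u(C^*(S))''=W^*(S),$$ where $''$ denotes the double commutant in $B(H_u)$. -/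

import Mathlib

open MeasureTheory Topology
open scoped ENNReal NNReal

universe u v

noncomputable section

namespace FoundationSemigroup

/-! ### Bounded regular complex Borel measures -/

section Measures

variable {S : Type u} [TopologicalSpace S] [T2Space S] [MeasurableSpace S] [BorelSpace S]

/-- A measure dominated by a finite inner regular measure is inner regular. -/
theorem innerRegular_of_le {μ ν : Measure S} [IsFiniteMeasure μ] [μ.InnerRegularCompactLTTop]
    (h : ν ≤ μ) : ν.InnerRegularCompactLTTop := by
  have : IsFiniteMeasure ν := isFiniteMeasure_of_le μ h
  refine ⟨fun s hs r hr => ?_⟩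
  have hpos : ν s - r ≠ 0 := (tsub_pos_of_lt hr).ne'
  obtain ⟨K, hKs, hK, hlt⟩ :=
    hs.1.exists_isCompact_sdiff_lt (μ := μ) (measure_ne_top μ s) hpos
  refine ⟨K, hKs, hK, ?_⟩
  have h1 : ν (s \ K) < ν s - r := (h _).trans_lt hlt
  have h2 : ν s ≤ ν (s \ K) + ν K := by
    calc ν s = ν ((s \ K) ∪ K) := by rw [Set.sdiff_union_of_subset hKs]
      _ ≤ _ := measure_union_le _ _
  by_contra hcon
  have h3 : ν K ≤ r := not_lt.mp hcon
  have h4 : ν s < (ν s - r) + r :=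
    h2.trans_lt (lt_of_lt_of_le
      (ENNReal.add_lt_add_right (measure_ne_top ν K) h1) (add_le_add le_rfl h3))
  rw [tsub_add_cancel_of_le hr.le] at h4
  exact lt_irrefl _ h4

variable (S) in
/-- The complex Borel measures whose total variation is finite and regular. -/
def regularMeasures : Submodule ℂ (ComplexMeasure S) where
  carrier := {μ | IsFiniteMeasure μ.variation ∧ μ.variation.Regular}
  zero_mem' := by
    simp only [Set.mem_ofPred_eq, VectorMeasure.variation_zero]
    exact ⟨inferInstance, inferInstance⟩
  add_mem' := by
    rintro μ ν ⟨h1, h2⟩ ⟨h3, h4⟩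
    have hle := VectorMeasure.variation_add_le (μ := μ) (ν := ν)
    have : IsFiniteMeasure (μ + ν).variation := isFiniteMeasure_of_le _ hle
    have := innerRegular_of_le hle
    exact ⟨inferInstance, inferInstance⟩
  smul_mem' := by
    rintro c μ ⟨h1, h2⟩
    simp only [Set.mem_ofPred_eq, VectorMeasure.variation_smul]
    exact ⟨inferInstance, inferInstance⟩

variable (S) in
/-- `M(S)`: the bounded regular complex Borel measures on `S`. -/
def M : Type u := regularMeasures S

namespace M

instance : AddCommGroup (M S) := inferInstanceAs (AddCommGroup (regularMeasures S))
instance : Module ℂ (M S) := inferInstanceAs (Module ℂ (regularMeasures S))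

/-- The underlying complex measure. -/
def val (μ : M S) : ComplexMeasure S := Subtype.val (p := (· ∈ regularMeasures S)) μ

/-- The total variation measure `|μ|`. -/
def absMeasure (μ : M S) : Measure S := μ.val.variation

instance (μ : M S) : IsFiniteMeasure μ.absMeasure := μ.2.1
instance (μ : M S) : μ.absMeasure.Regular := μ.2.2
instance (μ : M S) : IsFiniteMeasure μ.val.variation := μ.2.1

/-- The norm `‖μ‖ = |μ|(S)`. -/
instance : Norm (M S) := ⟨fun μ => μ.absMeasure.real Set.univ⟩

theorem norm_def (μ : M S) : ‖μ‖ = μ.absMeasure.real Set.univ := rfl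

theorem normCore : NormedSpace.Core ℂ (M S) where
  norm_nonneg μ := measureReal_nonneg
  norm_smul c μ := by
    change (c • μ.val).variation.real Set.univ = ‖c‖ * μ.val.variation.real Set.univ
    rw [VectorMeasure.variation_smul]
    rw [measureReal_nnreal_smul_apply, coe_nnnorm]
  norm_triangle μ ν := by
    change (μ.val + ν.val).variation.real Set.univ ≤
      μ.val.variation.real Set.univ + ν.val.variation.real Set.univ
    rw [← measureReal_add_apply]
    exact ENNReal.toReal_mono (measure_ne_top _ _)
      (VectorMeasure.variation_add_le (μ := μ.val) (ν := ν.val) Set.univ)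
  norm_eq_zero_iff μ := by
    change μ.val.variation.real Set.univ = 0 ↔ _
    rw [measureReal_eq_zero_iff, Measure.measure_univ_eq_zero, VectorMeasure.variation_eq_zero]
    exact ⟨fun h => Subtype.ext h, fun h => by rw [h]; rfl⟩

instance : NormedAddCommGroup (M S) := NormedAddCommGroup.ofCore normCore
instance : NormedSpace ℂ (M S) := NormedSpace.ofCore normCore

/-- A finite regular positive measure, seen as an element of `M(S)`. -/
def ofMeasure (ν : Measure S) [IsFiniteMeasure ν] [ν.Regular] : M S :=
  ⟨ν.toSignedMeasure.toComplexMeasure 0, by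
    have hle : (ν.toSignedMeasure.toComplexMeasure 0).variation ≤ ν := by
      refine VectorMeasure.variation_le_of_forall_enorm_le fun E hE => ?_
      have h0 : ν.toSignedMeasure.toComplexMeasure 0 E = ((ν.real E : ℝ) : ℂ) := by
        rw [SignedMeasure.toComplexMeasure_apply,
          Measure.toSignedMeasure_apply_measurable hE]
        rfl
      rw [h0, ← ofReal_norm, Complex.norm_real, Real.norm_of_nonneg measureReal_nonneg,
        ofReal_measureReal]
    have : IsFiniteMeasure (ν.toSignedMeasure.toComplexMeasure 0).variation :=
      isFiniteMeasure_of_le _ hle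
    have := innerRegular_of_le hle
    exact ⟨inferInstance, inferInstance⟩⟩

/-- `|μ|` as an element of `M(S)`. -/
def abs (μ : M S) : M S := ofMeasure μ.absMeasure

/-- The image of `μ ∈ M(S)` under a continuous map. -/
def push (μ : M S) (f : S → S) (hf : Continuous f) : M S :=
  ⟨μ.val.map f, by
    have hle := VectorMeasure.variation_map_le (μ := μ.val) (φ := f)
    have : IsFiniteMeasure (μ.val.map f).variation := isFiniteMeasure_of_le _ hle
    have : μ.val.variation.Regular := μ.2.2
    have : (μ.val.variation.map f).InnerRegularCompactLTTop :=
      Measure.InnerRegularCompactLTTop.map_of_continuous hf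
    have := innerRegular_of_le hle
    exact ⟨inferInstance, inferInstance⟩⟩

variable [Mul S] [ContinuousMul S]

/-- The convolution `μ * δ_x`: one has `∫ f d(μ * δ_x) = ∫ f(yx) dμ(y)`. -/
def mulDirac (μ : M S) (x : S) : M S := μ.push (fun y => y * x) (by fun_prop)

/-- The convolution `δ_x * μ`: one has `∫ f d(δ_x * μ) = ∫ f(xy) dμ(y)`. -/
def diracMul (x : S) (μ : M S) : M S := μ.push (fun y => x * y) (by fun_prop)

end M

variable [Mul S] [ContinuousMul S]

variable (S) in
/-- The semigroup algebra `L(S)`: those `μ ∈ M(S)` for which `x ↦ |μ| * δ_x` and `x ↦ δ_x * |μ|`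
are continuous for the weak topology `σ(M(S), M(S)*)`. -/
def L : Set (M S) :=
  {μ | Continuous (fun x : S => toWeakSpace ℂ (M S) (μ.abs.mulDirac x)) ∧
    Continuous (fun x : S => toWeakSpace ℂ (M S) (M.diracMul x μ.abs))}

variable (S) in
/-- `S` is a foundation semigroup: the supports of the measures in `L(S)` have dense union. -/
def IsFoundation : Prop := Dense (⋃ μ ∈ L S, μ.absMeasure.support)

end Measures

/-! ### Representations -/

/-- A weakly continuous `*`-representation of `S` by contractions on a Hilbert space, i.e. an
element of `Σ(S)`. -/
structure StarRep (S : Type u) [TopologicalSpace S] [Mul S] [Star S] where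
  /-- The Hilbert space. -/
  H : Type v
  [normed : NormedAddCommGroup H]
  [inner : InnerProductSpace ℂ H]
  [complete : CompleteSpace H]
  /-- The semigroup homomorphism into the bounded operators. -/
  hom : S →ₙ* (H →L[ℂ] H)
  map_star : ∀ x, hom (star x) = ContinuousLinearMap.adjoint (hom x)
  norm_le_one : ∀ x, ‖hom x‖ ≤ 1
  weak_continuous : ∀ ξ η : H, Continuous fun x => Inner.inner ℂ η (hom x ξ)

attribute [instance] StarRep.normed StarRep.inner StarRep.complete

section Representations

variable {S : Type u} [TopologicalSpace S] [Mul S] [Star S]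

variable (S) in
/-- `Σ(S)` separates the points of `S`. -/
def SeparatesPoints : Prop :=
  ∀ x y : S, x ≠ y → ∃ π : StarRep.{u, u} S, π.hom x ≠ π.hom y

namespace StarRep

/-- Topological irreducibility: `π` is not zero and has no closed invariant subspaces except
`0` and `H`. -/
def IsIrreducible (π : StarRep.{u, v} S) : Prop :=
  (∃ x, π.hom x ≠ 0) ∧
    ∀ K : Submodule ℂ π.H, IsClosed (K : Set π.H) → (∀ x, ∀ ξ ∈ K, π.hom x ξ ∈ K) →
      K = ⊥ ∨ K = ⊤

/-- `π` has a cyclic vector. -/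
def IsCyclic (π : StarRep.{u, v} S) : Prop :=
  ∃ ξ : π.H, Dense (Submodule.span ℂ (Set.range fun x => π.hom x ξ) : Set π.H)

end StarRep

/-! ### Hilbert sums of representations -/

/-- The Hilbert sum `⊕_{π ∈ ρ} H_π`. -/
abbrev HilbertSum (ρ : Set (StarRep.{u, v} S)) : Type (max u (v + 1)) :=
  lp (fun π : ρ => π.1.H) 2

/-- The Hilbert sum `⊕_{π ∈ ρ} π`. -/
@[reducible]
def sumRep (ρ : Set (StarRep.{u, v} S)) : StarRep.{u, max u (v + 1)} S where
  H := HilbertSum ρ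
  hom :=
    { toFun := fun x =>
        lp.mapCLM 2 (fun π : ρ => π.1.hom x) zero_le_one (fun π => π.1.norm_le_one x)
      map_mul' := fun x y => by
        ext ξ π
        simp }
  map_star x := by
    rw [ContinuousLinearMap.eq_adjoint_iff]
    intro ξ η
    rw [lp.inner_eq_tsum, lp.inner_eq_tsum]
    refine tsum_congr fun π => ?_
    simp [π.1.map_star, ContinuousLinearMap.adjoint_inner_left]
  norm_le_one x := lp.norm_mapCLM_le 2 _ zero_le_one fun π : ρ => π.1.norm_le_one x
  weak_continuous ξ η := by
    simp only [lp.inner_eq_tsum]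
    refine continuous_tsum (u := fun π : ρ => ‖η π‖ * ‖ξ π‖)
      (fun π => π.1.weak_continuous (ξ π) (η π)) ?_ ?_
    · have h := (lp.memℓp ξ).summable (by norm_num)
      have h' := (lp.memℓp η).summable (by norm_num)
      refine Summable.of_nonneg_of_le (fun π => by positivity) (fun π => ?_) (h'.add h)
      simp only [ENNReal.toReal_ofNat, Real.rpow_ofNat]
      nlinarith [sq_nonneg (‖η π‖ - ‖ξ π‖), sq_nonneg (‖η π‖), sq_nonneg (‖ξ π‖)]
    · intro π x
      refine (norm_inner_le_norm _ _).trans ?_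
      have : ‖π.1.hom x (ξ π)‖ ≤ ‖ξ π‖ := by
        simpa using (π.1.hom x).le_of_opNorm_le (π.1.norm_le_one x) (ξ π)
      gcongr
      exact this

end Representations

/-! ### Integrated representations and the semigroup `C*`-algebra -/

section Integrated

variable {S : Type u} [TopologicalSpace S] [T2Space S] [MeasurableSpace S] [BorelSpace S]

/-- The integral of a complex function against `μ ∈ M(S)`. -/
def M.integral (μ : M S) (f : S → ℂ) : ℂ :=
  μ.val.integral f (ContinuousLinearMap.mul ℝ ℂ)

theorem M.integral_const_mul (μ : M S) (c : ℂ) (f : S → ℂ) :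
    μ.integral (fun x => c * f x) = c * μ.integral f := by
  refine setToFun_smul _ (fun c s x => ?_) c f
  change (c * x) * μ.val s = c * (x * μ.val s)
  ring

variable [Mul S] [Star S]

namespace StarRep

variable (π : StarRep.{u, v} S) (μ : M S)

theorem integrable_coeff (ξ η : π.H) :
    μ.val.Integrable fun x => Inner.inner ℂ η (π.hom x ξ) := by
  refine Integrable.of_bound
    (π.weak_continuous ξ η).measurable.aestronglyMeasurable (‖η‖ * ‖ξ‖) ?_
  refine Filter.Eventually.of_forall fun x => (norm_inner_le_norm _ _).trans ?_
  have : ‖π.hom x ξ‖ ≤ ‖ξ‖ := by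
    simpa using (π.hom x).le_of_opNorm_le (π.norm_le_one x) ξ
  gcongr

theorem norm_integral_coeff_le (ξ η : π.H) :
    ‖μ.integral fun x => Inner.inner ℂ η (π.hom x ξ)‖ ≤ ‖μ‖ * ‖η‖ * ‖ξ‖ := by
  have hb : ∀ x, ‖Inner.inner ℂ η (π.hom x ξ)‖ ≤ ‖η‖ * ‖ξ‖ := fun x => by
    refine (norm_inner_le_norm _ _).trans ?_
    have : ‖π.hom x ξ‖ ≤ ‖ξ‖ := by
      simpa using (π.hom x).le_of_opNorm_le (π.norm_le_one x) ξ
    gcongr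
  have h := VectorMeasure.norm_integral_le_of_norm_le_const (μ := μ.val)
    (B := ContinuousLinearMap.mul ℝ ℂ) (Filter.Eventually.of_forall hb)
  have h1 : ‖ContinuousLinearMap.mul ℝ ℂ‖ ≤ 1 := ContinuousLinearMap.opNorm_mul_le ℝ ℂ
  refine h.trans ?_
  change ‖η‖ * ‖ξ‖ * ‖ContinuousLinearMap.mul ℝ ℂ‖ * ‖μ‖ ≤ _
  calc ‖η‖ * ‖ξ‖ * ‖ContinuousLinearMap.mul ℝ ℂ‖ * ‖μ‖ ≤ ‖η‖ * ‖ξ‖ * 1 * ‖μ‖ := by gcongr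
    _ = ‖μ‖ * ‖η‖ * ‖ξ‖ := by ring

/-- The sesquilinear form `(η, ξ) ↦ ∫ ⟨π(x)ξ, η⟩ dμ(x)`. -/
def form : π.H →L⋆[ℂ] π.H →L[ℂ] ℂ :=
  LinearMap.mkContinuous₂
    (LinearMap.mk₂'ₛₗ (starRingEnd ℂ) (RingHom.id ℂ)
      (fun η ξ => μ.integral fun x => Inner.inner ℂ η (π.hom x ξ))
      (fun η η' ξ => by
        simp only [inner_add_left]
        exact VectorMeasure.integral_fun_add (π.integrable_coeff μ ξ η)
          (π.integrable_coeff μ ξ η'))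
      (fun c η ξ => by
        simp only [inner_smul_left]
        exact μ.integral_const_mul _ _)
      (fun η ξ ξ' => by
        simp only [map_add, inner_add_right]
        exact VectorMeasure.integral_fun_add (π.integrable_coeff μ ξ η)
          (π.integrable_coeff μ ξ' η))
      (fun c η ξ => by
        simp only [map_smul, inner_smul_right]
        exact μ.integral_const_mul _ _))
    ‖μ‖ (fun η ξ => π.norm_integral_coeff_le μ ξ η)

/-- The integrated representation: `π̃(μ)` is the operator with
`⟨π̃(μ)ξ, η⟩ = ∫ ⟨π(x)ξ, η⟩ dμ(x)`. -/
def tilde : π.H →L[ℂ] π.H :=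
  ContinuousLinearMap.adjoint (InnerProductSpace.continuousLinearMapOfBilin (π.form μ))

/-- The defining property of `π̃(μ)` (in Mathlib the inner product is linear in the second
variable). -/
theorem inner_tilde (ξ η : π.H) :
    Inner.inner ℂ η (π.tilde μ ξ) = μ.integral fun x => Inner.inner ℂ η (π.hom x ξ) := by
  rw [tilde, ContinuousLinearMap.adjoint_inner_right,
    InnerProductSpace.continuousLinearMapOfBilin_apply]
  rfl

theorem norm_tilde_le : ‖π.tilde μ‖ ≤ ‖μ‖ := by
  refine ContinuousLinearMap.opNorm_le_bound _ (norm_nonneg _) fun ξ => ?_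
  have h := π.norm_integral_coeff_le μ ξ (π.tilde μ ξ)
  rw [← π.inner_tilde μ, inner_self_eq_norm_sq_to_K] at h
  by_cases h0 : ‖π.tilde μ ξ‖ = 0
  · rw [h0]; positivity
  · have h1 : 0 < ‖π.tilde μ ξ‖ := lt_of_le_of_ne (norm_nonneg _) (Ne.symm h0)
    simp only [norm_pow, Complex.coe_algebraMap, Complex.norm_real, norm_norm] at h
    nlinarith

end StarRep

variable (S) in
/-- The bounded product `∏_{π ∈ Σ(S)} B(H_π)` with the supremum norm. -/
abbrev BoundedProduct : Type (u + 1) :=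
  lp (fun π : StarRep.{u, u} S => π.H →L[ℂ] π.H) ∞

instance : NonUnitalCStarAlgebra (BoundedProduct S) := inferInstance
instance : NonUnitalRing (BoundedProduct S) := inferInstance
instance : NonUnitalSemiring (BoundedProduct S) := inferInstance

/-- The family `(π̃(μ))_{π ∈ Σ(S)}`. Its norm is `‖μ‖_Σ = sup_π ‖π̃(μ)‖`, so that this map induces
an isometry of `(L(S)/I_Σ, ‖·‖_Σ)` onto the image of `L(S)`. -/
def tildeFamily (μ : M S) : BoundedProduct S :=
  ⟨fun π => π.tilde μ, memℓp_infty ⟨‖μ‖, by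
    rintro _ ⟨π, rfl⟩
    exact π.norm_tilde_le μ⟩⟩

variable [ContinuousMul S]

variable (S) in
/-- The full semigroup `C*`-algebra `C*(S)`: the completion of `L(S)/I_Σ` for `‖·‖_Σ`, realized as
the closed `*`-algebra generated by the image of `L(S)` in the bounded product (that image is a
`*`-algebra, so this is its closure). -/
def CStar : NonUnitalStarSubalgebra ℂ (BoundedProduct S) :=
  (NonUnitalStarAlgebra.adjoin ℂ (tildeFamily '' L S)).topologicalClosure

/-- The extension to `C*(S)` of the integrated form of `⊕_{π ∈ ρ} π`. The extension of a single
`π̃` to `C*(S)` is the coordinate `a ↦ a π`. -/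
def extend (ρ : Set (StarRep.{u, u} S)) (a : CStar S) : HilbertSum ρ →L[ℂ] HilbertSum ρ :=
  lp.mapCLM 2 (fun π : ρ => (a : BoundedProduct S) π.1) (norm_nonneg (a : BoundedProduct S))
    (fun π => lp.norm_apply_le_norm ENNReal.top_ne_zero (a : BoundedProduct S) π.1)

/-- `extend ρ` does extend the integrated form of `⊕_{π ∈ ρ} π` from `L(S)` to `C*(S)`. -/
theorem extend_tildeFamily (ρ : Set (StarRep.{u, u} S)) (μ : M S) (h : tildeFamily μ ∈ CStar S) :
    extend ρ ⟨tildeFamily μ, h⟩ = (sumRep ρ).tilde μ := by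
  classical
  refine lp.ext_continuousLinearMap (by norm_num) fun π => ?_
  ext1 ξ
  have hsingle : ∀ (T : ∀ π : ρ, π.1.H →L[ℂ] π.1.H) (K : ℝ) (hK : 0 ≤ K)
      (hT : ∀ π, ‖T π‖ ≤ K), lp.mapCLM 2 T hK hT (lp.single 2 π ξ) = lp.single 2 π (T π ξ) := by
    intro T K hK hT
    ext σ
    by_cases hσ : σ = π
    · subst hσ; simp
    · simp [Pi.single_eq_of_ne hσ]
  refine ext_inner_left ℂ fun η => ?_
  change Inner.inner ℂ η (extend ρ ⟨tildeFamily μ, h⟩ (lp.single 2 π ξ)) =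
    Inner.inner ℂ η ((sumRep ρ).tilde μ (lp.single 2 π ξ))
  refine Eq.trans ?_ ((sumRep ρ).inner_tilde μ (lp.single 2 π ξ) η).symm
  rw [extend, hsingle, lp.inner_single_right]
  change Inner.inner ℂ (η π) (π.1.tilde μ ξ) = _
  rw [StarRep.inner_tilde]
  congr 1
  ext x
  have hx : (sumRep ρ).hom x (lp.single 2 π ξ) = lp.single 2 π (π.1.hom x ξ) :=
    hsingle (fun π : ρ => π.1.hom x) 1 zero_le_one (fun π => π.1.norm_le_one x)
  rw [hx, lp.inner_single_right]

/-! ### The operators in a universal representation -/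

/-- The operators `π_ρ(s)`, `s ∈ S`, where `π_ρ = ⊕_{π ∈ ρ} π`. -/
def semigroupOps (ρ : Set (StarRep.{u, u} S)) : Set (HilbertSum ρ →L[ℂ] HilbertSum ρ) :=
  Set.range fun s : S => (sumRep ρ).hom s

/-- The operators `π̃_ρ(μ)`, `μ ∈ L(S)`. -/
def measureOps (ρ : Set (StarRep.{u, u} S)) : Set (HilbertSum ρ →L[ℂ] HilbertSum ρ) :=
  (fun μ : M S => (sumRep ρ).tilde μ) '' L S

/-- The operators `π̃_ρ(a)`, `a ∈ C*(S)`. -/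
def cstarOps (ρ : Set (StarRep.{u, u} S)) : Set (HilbertSum ρ →L[ℂ] HilbertSum ρ) :=
  Set.range fun a : CStar S => extend ρ a

/-- The von Neumann algebra `W*(S)` on `⊕_{π ∈ ρ} H_π`: the closure of `π̃_ρ(C*(S))` in the weak
operator topology. It is the enveloping `W*`-algebra of `C*(S)` when `π_ρ` is universal. -/
def WStar (ρ : Set (StarRep.{u, u} S)) : Set (HilbertSum ρ →L[ℂ] HilbertSum ρ) :=
  {T | ContinuousLinearMapWOT.ofCLM T ∈ closure (ContinuousLinearMapWOT.ofCLM '' cstarOps ρ)}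

end Integrated

section Universal

variable (S : Type u) [TopologicalSpace S] [Mul S] [Star S]

/-- `Σ₀(S)`: the irreducible elements of `Σ(S)`. -/
def irreducibles : Set (StarRep.{u, u} S) := {π | π.IsIrreducible}

/-- The cyclic elements of `Σ(S)`. -/
def cyclics : Set (StarRep.{u, u} S) := {π | π.IsCyclic}

end Universal

/-- The double commutant `A''` in `B(H)`. -/
abbrev bicommutant {H : Type v} [NormedAddCommGroup H] [InnerProductSpace ℂ H]
    (A : Set (H →L[ℂ] H)) : Set (H →L[ℂ] H) :=
  Set.centralizer (Set.centralizer A)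

end FoundationSemigroup

end

/-! The point is that $\pi(S)$, $\tilde\pi(L(S))$ and $\tilde\pi(C^*(S))$ have the same commutant,
after which von Neumann's density theorem identifies the common bicommutant with $W^*(S)$.

An operator commuting with $\pi(S)$ passes through the integral defining $\tilde\pi(\mu)$.
Conversely, if $T$ commutes with $\tilde\pi(L(S))$, the bounded continuous function
$x\mapsto\langle\pi(x)T\xi,\eta\rangle-\langle\pi(x)\xi,T^*\eta\rangle$ integrates to zero against
all of $L(S)$. Membership in $L(S)$ depends only on $|\mu|$, so $|\mu|$ may be multiplied by the
conjugate phase of the function; its modulus then vanishes $|\mu|$-almost everywhere, and density of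
the supports makes it zero (`eq_zero_of_forall_integral_eq_zero`, `StarRep.centralizer_range_hom`).
Since $\pi(S)$ is self-adjoint, this commutant is too, so it also commutes with the closed
$*$-algebra generated by $L(S)$ (`centralizer_cstarOps`).

The density theorem (`bicommutant_eq_wotClosure`) needs nondegeneracy. A vector killed by
$\tilde\pi(L(S))$ is killed by $\pi(1)$, by the same separation property, and $\pi(1)=1$ for
irreducible and for cyclic representations. -/

noncomputable section

namespace FoundationSemigroup

/-! ### Phase changes of measures, and separation of functions by $L(S)$. -/

section Measures

/-- Integration against a complex measure given by a bounded density `u` with respect to its own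
total variation is integration of `f * u` against the total variation. -/
theorem integral_eq_integral_mul_density {X : Type*} [MeasurableSpace X] {ν : ComplexMeasure X}
    [IsFiniteMeasure ν.variation] {u : X → ℂ} (hu : Measurable u) {C : ℝ} (hC : ∀ x, ‖u x‖ ≤ C)
    (h : ∀ s, MeasurableSet s → ν s = ∫ x in s, u x ∂ν.variation)
    {f : X → ℂ} (hf : Integrable f ν.variation) :
    ν.integral f (ContinuousLinearMap.mul ℝ ℂ) = ∫ x, f x * u x ∂ν.variation := by
  have hmul : ∀ {g : X → ℂ}, Integrable g ν.variation →
      Integrable (fun x => g x * u x) ν.variation := fun hg =>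
    hg.mul_bdd (c := C) hu.aestronglyMeasurable (Filter.Eventually.of_forall hC)
  revert f
  refine Integrable.induction _ ?_ ?_ ?_ ?_
  · intro c s hs _
    rw [VectorMeasure.integral_indicator_const _ hs, h s hs]
    have : (fun x => s.indicator (fun _ => c) x * u x) = s.indicator fun x => c * u x := by
      ext x; by_cases hx : x ∈ s <;> simp [hx]
    rw [this, integral_indicator hs, integral_const_mul]
    rfl
  · intro f g _ hf hg h1 h2
    rw [VectorMeasure.integral_add hf hg, h1, h2, ← integral_add (hmul hf) (hmul hg)]
    simp [add_mul]
  · refine isClosed_eq VectorMeasure.continuous_integral ?_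
    -- The bound on the density makes the right-hand side Lipschitz in the $L^1$ norm, so the set
    -- where the identity holds is closed.
    have hlip : LipschitzWith C.toNNReal
        fun f : X →₁[ν.variation] ℂ => ∫ x, f x * u x ∂ν.variation := by
      refine LipschitzWith.of_dist_le_mul fun f g => ?_
      have hf := L1.integrable_coeFn f
      have hg := L1.integrable_coeFn g
      rw [dist_eq_norm, ← integral_sub (hmul hf) (hmul hg), L1.dist_eq_integral_dist,
        ← integral_const_mul]
      refine norm_integral_le_of_norm_le ?_ (Filter.Eventually.of_forall fun x => ?_)
      · exact ((hf.sub hg).norm.congr (by simp [dist_eq_norm])).const_mul _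
      · rw [← sub_mul, norm_mul, dist_eq_norm, mul_comm]
        gcongr
        exact (hC x).trans (Real.le_coe_toNNReal C)
    exact hlip.continuous
  · intro f g hfg _ hf
    rw [← VectorMeasure.integral_congr_ae hfg, hf]
    refine integral_congr_ae ?_
    filter_upwards [hfg] with x hx
    rw [hx]

variable {S : Type u} [TopologicalSpace S] [T2Space S] [MeasurableSpace S] [BorelSpace S]

theorem M.abs_congr {μ ν : M S} (h : μ.absMeasure = ν.absMeasure) : μ.abs = ν.abs := by
  refine Subtype.ext ?_
  change μ.absMeasure.toSignedMeasure.toComplexMeasure 0 =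
    ν.absMeasure.toSignedMeasure.toComplexMeasure 0
  congr 1
  exact Measure.toSignedMeasure_congr h

/-- The variation of $u\,|\mu|$ has density $|u|=1$. Finiteness, regularity and membership in $L(S)$
therefore survive a change of phase. -/
theorem M.variation_withDensity_unimodular (μ : M S) {u : S → ℂ} (hu : Measurable u)
    (h1 : ∀ x, ‖u x‖ = 1) :
    (μ.absMeasure.withDensityᵥ u).variation = μ.absMeasure := by
  have hint : Integrable u μ.absMeasure :=
    Integrable.of_bound hu.aestronglyMeasurable 1
      (Filter.Eventually.of_forall fun x => (h1 x).le)
  rw [Measure.variation_withDensityᵥ hint]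
  have : (fun x => ‖u x‖ₑ) = 1 := by
    ext x
    rw [← ofReal_norm, h1]
    simp
  rw [this, withDensity_one]

/-- The measure `u • |μ|`, where `u` is measurable of modulus one. -/
def M.unimodularDensity (μ : M S) (u : S → ℂ) (hu : Measurable u) (h1 : ∀ x, ‖u x‖ = 1) : M S :=
  ⟨μ.absMeasure.withDensityᵥ u, by
    change IsFiniteMeasure _ ∧ Measure.Regular _
    rw [μ.variation_withDensity_unimodular hu h1]
    exact ⟨inferInstance, inferInstance⟩⟩

theorem M.absMeasure_unimodularDensity (μ : M S) {u : S → ℂ} (hu : Measurable u)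
    (h1 : ∀ x, ‖u x‖ = 1) : (μ.unimodularDensity u hu h1).absMeasure = μ.absMeasure :=
  μ.variation_withDensity_unimodular hu h1

theorem M.integral_unimodularDensity (μ : M S) {u : S → ℂ} (hu : Measurable u)
    (h1 : ∀ x, ‖u x‖ = 1) {f : S → ℂ} (hf : Integrable f μ.absMeasure) :
    (μ.unimodularDensity u hu h1).integral f = ∫ x, f x * u x ∂μ.absMeasure := by
  have hvar : (μ.unimodularDensity u hu h1).val.variation = μ.absMeasure :=
    μ.absMeasure_unimodularDensity hu h1
  have hint : Integrable u μ.absMeasure :=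
    Integrable.of_bound hu.aestronglyMeasurable 1
      (Filter.Eventually.of_forall fun x => (h1 x).le)
  rw [M.integral, integral_eq_integral_mul_density (C := 1) hu (fun x => (h1 x).le), hvar]
  · intro s hs
    rw [hvar]
    exact withDensityᵥ_apply hint hs
  · rwa [hvar]

variable [Mul S] [ContinuousMul S]

/-- The conditions defining `L S` see a measure only through its total variation. -/
theorem M.unimodularDensity_mem_L {μ : M S} (hμ : μ ∈ L S) {u : S → ℂ} (hu : Measurable u)
    (h1 : ∀ x, ‖u x‖ = 1) : μ.unimodularDensity u hu h1 ∈ L S := by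
  have h := M.abs_congr (μ.absMeasure_unimodularDensity hu h1)
  change Continuous _ ∧ Continuous _
  rw [h]
  exact hμ

/-- On a foundation semigroup, the measures of `L(S)` separate the bounded continuous functions. -/
theorem eq_zero_of_forall_integral_eq_zero (hS : IsFoundation S) {f : S → ℂ} (hf : Continuous f)
    {C : ℝ} (hC : ∀ x, ‖f x‖ ≤ C) (h : ∀ μ ∈ L S, μ.integral f = 0) (x : S) : f x = 0 := by
  by_contra hx
  have hopen : IsOpen {y | f y ≠ 0} := isOpen_ne_fun hf continuous_const
  obtain ⟨y, hy, hyS⟩ := hS.inter_open_nonempty _ hopen ⟨x, hx⟩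
  simp only [Set.mem_iUnion, exists_prop] at hyS
  obtain ⟨μ, hμ, hyμ⟩ := hyS
  have hpos := (Measure.mem_support_iff_forall y).1 hyμ _ (hopen.mem_nhds hy)
  -- The conjugate phase of `f`, so that `f * u = ‖f‖`; the value `1` on the zero set keeps `u` of
  -- modulus one everywhere.
  let u : S → ℂ := fun y => if f y = 0 then 1 else star (f y) / ‖f y‖
  have hu : Measurable u :=
    Measurable.ite (measurableSet_eq_fun hf.measurable measurable_const) measurable_const
      (hf.star.measurable.div (Complex.measurable_ofReal.comp hf.measurable.norm))
  have h1 : ∀ y, ‖u y‖ = 1 := by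
    intro y
    by_cases h0 : f y = 0
    · simp [u, h0]
    · simp [u, h0]
  have hint : Integrable f μ.absMeasure :=
    Integrable.of_bound hf.measurable.aestronglyMeasurable C (Filter.Eventually.of_forall hC)
  have h2 := h _ (M.unimodularDensity_mem_L hμ hu h1)
  rw [M.integral_unimodularDensity μ hu h1 hint] at h2
  have h3 : ∀ y, f y * u y = (‖f y‖ : ℂ) := by
    intro y
    by_cases h0 : f y = 0
    · simp [u, h0]
    · have h0' : (‖f y‖ : ℂ) ≠ 0 := by simpa using h0
      simp only [u, if_neg h0]
      rw [mul_div_assoc', div_eq_iff h0']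
      simpa [sq] using Complex.mul_conj' (f y)
  simp only [h3] at h2
  rw [integral_complex_ofReal] at h2
  have h4 := (integral_eq_zero_iff_of_nonneg (fun _ => norm_nonneg _) hint.norm).1
    (by exact_mod_cast h2)
  -- The open set `{f ≠ 0}` is now null, yet it contains a point of the support of `μ`.
  refine hpos.ne' (measure_mono_null (fun z hz => ?_) (ae_iff.1 h4))
  simpa using hz

end Measures

/-! ### Von Neumann's double commutant theorem without an identity in the algebra. -/

section DoubleCommutant

open ContinuousLinearMap

section Diagonal

variable {ι : Type*} {E : ι → Type*} [∀ i, NormedAddCommGroup (E i)]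
  [∀ i, InnerProductSpace ℂ (E i)]

theorem mapCLM_single [DecidableEq ι] (T : ∀ i, E i →L[ℂ] E i) {K : ℝ} (hK : 0 ≤ K)
    (hT : ∀ i, ‖T i‖ ≤ K) (i : ι) (x : E i) :
    lp.mapCLM 2 T hK hT (lp.single 2 i x) = lp.single 2 i (T i x) := by
  ext j
  by_cases hj : j = i
  · subst hj; simp
  · simp [Pi.single_eq_of_ne hj]

theorem adjoint_mapCLM [∀ i, CompleteSpace (E i)] (T : ∀ i, E i →L[ℂ] E i) {K : ℝ} (hK : 0 ≤ K)
    (hT : ∀ i, ‖T i‖ ≤ K) {K' : ℝ} (hK' : 0 ≤ K') (hT' : ∀ i, ‖adjoint (T i)‖ ≤ K') :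
    adjoint (lp.mapCLM 2 T hK hT) = lp.mapCLM 2 (fun i => adjoint (T i)) hK' hT' := by
  symm
  rw [eq_adjoint_iff]
  intro x y
  rw [lp.inner_eq_tsum, lp.inner_eq_tsum]
  refine tsum_congr fun i => ?_
  simp [adjoint_inner_left]

end Diagonal

variable {H : Type*} [NormedAddCommGroup H] [InnerProductSpace ℂ H]

/-- The amplification `T ⊕ T ⊕ ⋯` on `ℓ²(ι, H)`. -/
def amplify (ι : Type*) (T : H →L[ℂ] H) : lp (fun _ : ι => H) 2 →L[ℂ] lp (fun _ : ι => H) 2 :=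
  lp.mapCLM 2 (fun _ => T) (norm_nonneg T) (fun _ => le_rfl)

@[simp]
theorem amplify_apply {ι : Type*} (T : H →L[ℂ] H) (x : lp (fun _ : ι => H) 2) (i : ι) :
    amplify ι T x i = T (x i) := by
  simp [amplify]

/-- If every matrix entry of `P` commutes with `T`, then `P` commutes with the amplification
of `T`. -/
theorem commute_amplify_of_entries {ι : Type*} [DecidableEq ι] {T : H →L[ℂ] H}
    {P : lp (fun _ : ι => H) 2 →L[ℂ] lp (fun _ : ι => H) 2}
    (h : ∀ i j x, P (lp.single 2 j (T x)) i = T (P (lp.single 2 j x) i)) :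
    P * amplify ι T = amplify ι T * P := by
  refine lp.ext_continuousLinearMap (by norm_num) fun j => ?_
  ext x i
  change P (amplify ι T (lp.single 2 j x)) i = amplify ι T (P (lp.single 2 j x)) i
  rw [amplify_apply, ← h, amplify, mapCLM_single]

/-- Left and right multiplication by a fixed operator are continuous in the weak operator topology,
so a commutant is an intersection of closed equalizers. -/
theorem isClosed_centralizer_wot (B : Set (H →L[ℂ] H)) :
    IsClosed (ContinuousLinearMapWOT.toCLM ⁻¹' Set.centralizer B :
      Set (H →WOT[ℂ] H)) := by
  have : (ContinuousLinearMapWOT.toCLM ⁻¹' Set.centralizer B : Set (H →WOT[ℂ] H)) =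
      ⋂ b ∈ B, {T | ContinuousLinearMapWOT.comp (.ofCLM b) T =
        ContinuousLinearMapWOT.comp T (.ofCLM b)} := by
    ext T
    simp only [Set.mem_preimage, Set.mem_centralizer_iff, Set.mem_iInter, Set.mem_ofPred_eq]
    refine forall₂_congr fun b _ => ?_
    exact ContinuousLinearMapWOT.toCLM_injective.eq_iff
      (a := ContinuousLinearMapWOT.ofCLM b * T) (b := T * ContinuousLinearMapWOT.ofCLM b)
  rw [this]
  exact isClosed_biInter fun b _ => isClosed_eq
    (ContinuousLinearMapWOT.continuous_postcomp _) (ContinuousLinearMapWOT.continuous_precomp _)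

variable [CompleteSpace H]

theorem adjoint_amplify {ι : Type*} (T : H →L[ℂ] H) :
    adjoint (amplify ι T) = amplify ι (adjoint T) :=
  adjoint_mapCLM _ _ _ _ _

/-- The orthogonal projection on a reducing subspace of `T` commutes with `T`. -/
theorem starProjection_commute {T : H →L[ℂ] H} (K : Submodule ℂ H) [K.HasOrthogonalProjection]
    (h : ∀ x ∈ K, T x ∈ K) (hadj : ∀ x ∈ K, adjoint T x ∈ K) :
    K.starProjection * T = T * K.starProjection := by
  ext x
  change K.starProjection (T x) = T (K.starProjection x)
  -- `T (P x)` lies in `K`, and `T (x - P x)` is orthogonal to `K` because the adjoint of `T`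
  -- preserves `K`; this characterizes the projection of `T x`.
  refine (Submodule.eq_starProjection_of_mem_orthogonal (h _ (K.starProjection_apply_mem x)) ?_)
  rw [← map_sub, Submodule.mem_orthogonal]
  intro y hy
  rw [← adjoint_inner_left]
  exact (Submodule.mem_orthogonal _ _).1 (K.sub_starProjection_mem_orthogonal x) _ (hadj y hy)

/-- Approximation on finitely many vectors of an operator in the double commutant of a
nondegenerate `*`-algebra. -/
theorem exists_norm_sub_lt_of_mem_bicommutant (A : NonUnitalStarSubalgebra ℂ (H →L[ℂ] H))
    (hA : ∀ x : H, (∀ a ∈ A, a x = 0) → x = 0) {T : H →L[ℂ] H}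
    (hT : T ∈ bicommutant (A : Set (H →L[ℂ] H))) {ι : Type*} [Finite ι] (x : ι → H)
    {ε : ℝ} (hε : 0 < ε) : ∃ a ∈ A, ∀ i, ‖T (x i) - a (x i)‖ < ε := by
  classical
  -- The finitely many vectors become one vector of the amplified space, and `K` below is the
  -- closure of its orbit under `A`.
  let ξ : lp (fun _ : ι => H) 2 := ⟨x, Memℓp.all x⟩
  let K₀ : Submodule ℂ (lp (fun _ : ι => H) 2) :=
    { carrier := {y | ∃ a ∈ A, amplify ι a ξ = y}
      zero_mem' := ⟨0, zero_mem A, by ext; simp⟩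
      add_mem' := by
        rintro _ _ ⟨a, ha, rfl⟩ ⟨b, hb, rfl⟩
        exact ⟨a + b, add_mem ha hb, by ext; simp⟩
      smul_mem' := by
        rintro c _ ⟨a, ha, rfl⟩
        exact ⟨c • a, SMulMemClass.smul_mem c ha, by ext; simp⟩ }
  let K := K₀.topologicalClosure
  have hK₀ : ∀ a ∈ A, ∀ y ∈ K₀, amplify ι a y ∈ K₀ := by
    rintro a ha _ ⟨b, hb, rfl⟩
    exact ⟨a * b, mul_mem ha hb, by ext; simp⟩
  have hK : ∀ a ∈ A, ∀ y ∈ K, amplify ι a y ∈ K := fun a ha y hy =>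
    map_mem_closure (amplify ι a).continuous hy (hK₀ a ha)
  have : CompleteSpace K := K₀.isClosed_topologicalClosure.completeSpace_coe
  let P := K.starProjection
  have hP : ∀ a ∈ A, P * amplify ι a = amplify ι a * P := fun a ha =>
    starProjection_commute K (hK a ha) (by
      rw [adjoint_amplify]
      exact hK _ (star_mem (s := A) ha))
  -- Without an identity in `A` this needs nondegeneracy: `a (P ξ) = P (a ξ) = a ξ` for `a ∈ A`, so
  -- `A` kills every coordinate of `ξ - P ξ`.
  have hξ : ξ ∈ K := by
    rw [← Submodule.starProjection_eq_self_iff, eq_comm, ← sub_eq_zero]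
    ext i
    refine hA _ fun a ha => ?_
    rw [← amplify_apply (ι := ι) a, map_sub]
    have h1 : amplify ι a (P ξ) = P (amplify ι a ξ) := (DFunLike.congr_fun (hP a ha) ξ).symm
    have h2 : P (amplify ι a ξ) = amplify ι a ξ :=
      Submodule.starProjection_eq_self_iff.2 (K₀.le_topologicalClosure ⟨a, ha, rfl⟩)
    rw [h1, h2, sub_self]
    rfl
  -- The matrix entries `Q` of `P` commute with `A`, hence with `T`, which lies in the bicommutant.
  have hPT : P * amplify ι T = amplify ι T * P := by
    refine commute_amplify_of_entries fun i j y => ?_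
    let Q : H →L[ℂ] H := (lp.evalCLM ℂ (fun _ : ι => H) 2 i).comp
      (P.comp (lp.singleContinuousLinearMap ℂ (fun _ : ι => H) 2 j))
    have hQ : Q ∈ Set.centralizer (A : Set (H →L[ℂ] H)) := by
      intro a ha
      ext z
      change a (P (lp.single 2 j z) i) = P (lp.single 2 j (a z)) i
      have h1 := DFunLike.congr_fun (hP a ha) (lp.single 2 j z)
      change P (amplify ι a (lp.single 2 j z)) = amplify ι a (P (lp.single 2 j z)) at h1
      rw [← amplify_apply a, ← h1, amplify, mapCLM_single]
    exact DFunLike.congr_fun (hT Q hQ) y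
  have hmem : amplify ι T ξ ∈ K := by
    rw [← Submodule.starProjection_eq_self_iff]
    have h1 : P (amplify ι T ξ) = amplify ι T (P ξ) := DFunLike.congr_fun hPT ξ
    have h2 : P ξ = ξ := Submodule.starProjection_eq_self_iff.2 hξ
    rwa [h2] at h1
  obtain ⟨_, ⟨a, ha, rfl⟩, hlt⟩ := Metric.mem_closure_iff.1 hmem ε hε
  refine ⟨a, ha, fun i => lt_of_le_of_lt ?_ hlt⟩
  rw [dist_eq_norm]
  have h3 := lp.norm_apply_le_norm (p := 2) (by norm_num) (amplify ι T ξ - amplify ι a ξ) i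
  simpa [ξ] using h3

/-- **Von Neumann's double commutant theorem** for a nondegenerate `*`-algebra of operators and
the weak operator topology. -/
theorem bicommutant_eq_wotClosure (A : NonUnitalStarSubalgebra ℂ (H →L[ℂ] H))
    (hA : ∀ x : H, (∀ a ∈ A, a x = 0) → x = 0) :
    bicommutant (A : Set (H →L[ℂ] H)) = {T | ContinuousLinearMapWOT.ofCLM T ∈
      closure (ContinuousLinearMapWOT.ofCLM '' (A : Set (H →L[ℂ] H)))} := by
  apply Set.Subset.antisymm
  · intro T hT
    change ContinuousLinearMapWOT.ofCLM T ∈ closure _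
    rw [mem_closure_iff_nhds]
    intro U hU
    obtain ⟨s, r, hr, hsub⟩ := (ContinuousLinearMapWOT.withSeminorms.mem_nhds_iff _ _).1 hU
    -- A basic weak neighbourhood is given by finitely many pairs of a vector `p.1` and a functional
    -- `p.2`. The summand `1` makes `C` positive and strictly larger than each `‖p.2‖`.
    let C : ℝ := 1 + ∑ p ∈ s, ‖p.2‖
    have hC : 0 < C := by positivity
    obtain ⟨a, ha, hlt⟩ := exists_norm_sub_lt_of_mem_bicommutant A hA hT
      (fun p : s => p.1.1) (div_pos hr hC)
    refine ⟨ContinuousLinearMapWOT.ofCLM a, hsub ?_, a, ha, rfl⟩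
    rw [Seminorm.mem_ball]
    refine Seminorm.finset_sup_apply_lt hr fun p hp => ?_
    change ‖p.2 (a p.1 - T p.1)‖ < r
    have h1 : ‖p.2‖ < C :=
      (Finset.single_le_sum (fun q _ => norm_nonneg q.2) hp).trans_lt (lt_one_add _)
    have h2 : ‖a p.1 - T p.1‖ < r / C := by
      rw [norm_sub_rev]
      exact hlt ⟨p, hp⟩
    calc ‖p.2 (a p.1 - T p.1)‖ ≤ ‖p.2‖ * ‖a p.1 - T p.1‖ := p.2.le_opNorm _
      _ ≤ C * ‖a p.1 - T p.1‖ := by gcongr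
      _ < C * (r / C) := by gcongr
      _ = r := mul_div_cancel₀ r hC.ne'
  · exact fun T hT => closure_minimal (by
      rintro _ ⟨a, ha, rfl⟩
      exact Set.subset_centralizer_centralizer ha) (isClosed_centralizer_wot _) hT

end DoubleCommutant

theorem bicommutant_congr {H : Type*} [NormedAddCommGroup H] [InnerProductSpace ℂ H]
    {A B : Set (H →L[ℂ] H)} (h : Set.centralizer A = Set.centralizer B) :
    bicommutant A = bicommutant B :=
  congrArg (fun C => Set.centralizer C) h

/-! ### Comparison of the commutants of $\pi(S)$ and $\tilde\pi(L(S))$. -/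

section Commutants

open ContinuousLinearMap

variable {S : Type u} [TopologicalSpace S]

theorem StarRep.norm_coeff_le [Mul S] [Star S] (π : StarRep.{u, v} S) (ξ η : π.H) (x : S) :
    ‖Inner.inner ℂ η (π.hom x ξ)‖ ≤ ‖η‖ * ‖ξ‖ := by
  refine (norm_inner_le_norm _ _).trans ?_
  gcongr
  simpa using (π.hom x).le_of_opNorm_le (π.norm_le_one x) ξ

section ProductRep

variable [Mul S] [Star S]

/-- The operator `⊕_{π ∈ ρ} a_π` on `⊕_{π ∈ ρ} H_π`. -/
def productOp (ρ : Set (StarRep.{u, u} S)) (a : BoundedProduct S) :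
    HilbertSum ρ →L[ℂ] HilbertSum ρ :=
  lp.mapCLM 2 (fun π : ρ => a π.1) (norm_nonneg a)
    (fun π => lp.norm_apply_le_norm ENNReal.top_ne_zero a π.1)

theorem productOp_star (ρ : Set (StarRep.{u, u} S)) (a : BoundedProduct S) :
    productOp ρ (star a) = adjoint (productOp ρ a) := by
  rw [eq_adjoint_iff]
  intro ξ η
  rw [lp.inner_eq_tsum, lp.inner_eq_tsum]
  refine tsum_congr fun π => ?_
  change Inner.inner ℂ (star (a π.1) (ξ π)) (η π) = Inner.inner ℂ (ξ π) (a π.1 (η π))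
  rw [star_eq_adjoint, adjoint_inner_left]

/-- The representation of the bounded product on `⊕_{π ∈ ρ} H_π`. -/
def productRep (ρ : Set (StarRep.{u, u} S)) :
    BoundedProduct S →⋆ₙₐ[ℂ] (HilbertSum ρ →L[ℂ] HilbertSum ρ) where
  toFun := productOp ρ
  map_smul' _ _ := ContinuousLinearMap.ext fun _ => lp.ext (funext fun _ => rfl)
  map_zero' := ContinuousLinearMap.ext fun _ => lp.ext (funext fun _ => rfl)
  map_add' _ _ := ContinuousLinearMap.ext fun _ => lp.ext (funext fun _ => rfl)
  map_mul' _ _ := ContinuousLinearMap.ext fun _ => lp.ext (funext fun _ => rfl)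
  map_star' := productOp_star ρ

theorem continuous_productRep (ρ : Set (StarRep.{u, u} S)) : Continuous (productRep ρ) :=
  AddMonoidHomClass.continuous_of_bound (productRep ρ) 1 fun a => by
    rw [one_mul]
    exact lp.norm_mapCLM_le 2 (fun π : ρ => a π.1) (norm_nonneg a)
      (fun π => lp.norm_apply_le_norm ENNReal.top_ne_zero a π.1)

end ProductRep

variable [T2Space S] [MeasurableSpace S] [BorelSpace S]

/-- An operator commuting with `π(S)` commutes with the integrated representation. -/
theorem StarRep.tilde_commute [Mul S] [Star S] (π : StarRep.{u, v} S) {T : π.H →L[ℂ] π.H}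
    (hT : T ∈ Set.centralizer (Set.range π.hom)) (μ : M S) : π.tilde μ * T = T * π.tilde μ := by
  ext ξ
  refine ext_inner_left ℂ fun η => ?_
  change Inner.inner ℂ η (π.tilde μ (T ξ)) = Inner.inner ℂ η (T (π.tilde μ ξ))
  -- Moving `T` onto `η` turns both sides into integrals of coefficient functions, which agree
  -- pointwise.
  rw [π.inner_tilde, ← adjoint_inner_left, π.inner_tilde]
  congr 1
  ext x
  rw [adjoint_inner_left]
  exact congrArg _ (DFunLike.congr_fun (hT _ ⟨x, rfl⟩) ξ)

variable [Mul S] [Star S] [ContinuousMul S]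

/-- On a foundation semigroup, `π(S)` and `π̃(L(S))` have the same commutant. -/
theorem StarRep.centralizer_range_hom (π : StarRep.{u, v} S) (hS : IsFoundation S) :
    Set.centralizer (Set.range π.hom) = Set.centralizer (π.tilde '' L S) := by
  apply Set.Subset.antisymm
  · rintro T hT _ ⟨μ, -, rfl⟩
    exact π.tilde_commute hT μ
  · rintro T hT _ ⟨x, rfl⟩
    ext ξ
    refine ext_inner_left ℂ fun η => ?_
    change Inner.inner ℂ η (π.hom x (T ξ)) = Inner.inner ℂ η (T (π.hom x ξ))
    rw [← sub_eq_zero, ← adjoint_inner_left T]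
    refine eq_zero_of_forall_integral_eq_zero hS
      (f := fun x => Inner.inner ℂ η (π.hom x (T ξ)) - Inner.inner ℂ (adjoint T η) (π.hom x ξ))
      ((π.weak_continuous _ _).sub (π.weak_continuous _ _))
      (fun x => (norm_sub_le _ _).trans
        (add_le_add (π.norm_coeff_le _ _ x) (π.norm_coeff_le _ _ x))) (fun μ hμ => ?_) x
    have h1 : μ.integral (fun x => Inner.inner ℂ η (π.hom x (T ξ)) -
        Inner.inner ℂ (adjoint T η) (π.hom x ξ)) =
        μ.integral (fun x => Inner.inner ℂ η (π.hom x (T ξ))) -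
        μ.integral (fun x => Inner.inner ℂ (adjoint T η) (π.hom x ξ)) :=
      VectorMeasure.integral_fun_sub (π.integrable_coeff μ _ _) (π.integrable_coeff μ _ _)
    rw [h1, ← π.inner_tilde, ← π.inner_tilde, adjoint_inner_left, sub_eq_zero]
    exact congrArg _ (DFunLike.congr_fun (hT _ ⟨μ, hμ, rfl⟩) ξ)

/-- A vector killed by `π̃(L(S))` is killed by `π(S)`. -/
theorem StarRep.hom_apply_eq_zero (π : StarRep.{u, v} S) (hS : IsFoundation S) {ξ : π.H}
    (h : ∀ μ ∈ L S, π.tilde μ ξ = 0) (x : S) : π.hom x ξ = 0 := by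
  refine ext_inner_left ℂ fun η => ?_
  rw [inner_zero_right]
  refine eq_zero_of_forall_integral_eq_zero hS (π.weak_continuous ξ η)
    (π.norm_coeff_le ξ η) (fun μ hμ => ?_) x
  rw [← π.inner_tilde, h μ hμ, inner_zero_right]

/-- This exhibits `cstarOps ρ` as a $*$-subalgebra, the form in which the double commutant theorem
applies to it. -/
theorem coe_map_productRep (ρ : Set (StarRep.{u, u} S)) :
    ((CStar S).map (productRep ρ) : Set (HilbertSum ρ →L[ℂ] HilbertSum ρ)) = cstarOps ρ := by
  ext T
  constructor
  · rintro ⟨a, ha, rfl⟩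
    exact ⟨⟨a, ha⟩, rfl⟩
  · rintro ⟨a, rfl⟩
    exact ⟨a.1, a.2, rfl⟩

theorem tildeFamily_mem_CStar {μ : M S} (hμ : μ ∈ L S) : tildeFamily μ ∈ CStar S :=
  NonUnitalStarSubalgebra.le_topologicalClosure _
    (NonUnitalStarAlgebra.subset_adjoin ℂ _ ⟨μ, hμ, rfl⟩)

theorem productRep_tildeFamily (ρ : Set (StarRep.{u, u} S)) {μ : M S} (hμ : μ ∈ L S) :
    productRep ρ (tildeFamily μ) = (sumRep ρ).tilde μ :=
  extend_tildeFamily ρ μ (tildeFamily_mem_CStar hμ)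

theorem measureOps_subset_cstarOps (ρ : Set (StarRep.{u, u} S)) : measureOps ρ ⊆ cstarOps ρ := by
  rintro _ ⟨μ, hμ, rfl⟩
  exact ⟨⟨_, tildeFamily_mem_CStar hμ⟩, extend_tildeFamily ρ μ _⟩

end Commutants

/-! ### Nondegeneracy, the commutant of $\tilde\pi(C^*(S))$, and the conclusion. -/

section Universal

open ContinuousLinearMap

variable {S : Type u} [Monoid S] [StarMul S] [TopologicalSpace S]

theorem StarRep.centralizer_range_hom_star (π : StarRep.{u, v} S) {T : π.H →L[ℂ] π.H}
    (hT : T ∈ Set.centralizer (Set.range π.hom)) :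
    star T ∈ Set.centralizer (Set.range π.hom) := by
  rintro _ ⟨x, rfl⟩
  have h := congrArg star (hT _ ⟨star x, rfl⟩)
  rw [star_mul, star_mul, π.map_star, star_eq_adjoint (adjoint _), adjoint_adjoint] at h
  exact h.symm

/-- `π(1)` fixes every `π(x)ξ`, and these span a dense subspace. -/
theorem StarRep.IsCyclic.hom_one {π : StarRep.{u, v} S} (h : π.IsCyclic) : π.hom 1 = 1 := by
  obtain ⟨ξ, hξ⟩ := h
  refine ContinuousLinearMap.ext_on hξ ?_
  rintro _ ⟨x, rfl⟩
  change (π.hom 1 * π.hom x) ξ = π.hom x ξ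
  rw [← map_mul, one_mul]

/-- The fixed space of `π(1)` is closed and contains the range of every `π(y)`. It is thus
invariant, and nonzero because `π` is. -/
theorem StarRep.IsIrreducible.hom_one {π : StarRep.{u, v} S} (h : π.IsIrreducible) :
    π.hom 1 = 1 := by
  obtain ⟨⟨x, hx⟩, hK⟩ := h
  let K : Submodule ℂ π.H := (π.hom 1 - 1).ker
  have hmem : ∀ y ξ, π.hom y ξ ∈ K := fun y ξ => by
    change (π.hom 1 * π.hom y) ξ - π.hom y ξ = 0
    rw [← map_mul, one_mul, sub_self]
  rcases hK K (π.hom 1 - 1).isClosed_ker (fun y ξ _ => hmem y ξ) with h | h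
  · refine absurd (ContinuousLinearMap.ext fun ξ => ?_) hx
    have := hmem x ξ
    rwa [h] at this
  · ext ξ
    have : ξ ∈ K := h ▸ Submodule.mem_top
    exact sub_eq_zero.1 this

variable [T2Space S] [MeasurableSpace S] [BorelSpace S] [ContinuousMul S]

/-- To commute with the generated $*$-algebra, an operator must commute with the generators and
their adjoints. The adjoints are reached by passing through the commutant of $\pi(S)$, which is
closed under `star`. -/
theorem centralizer_cstarOps (hS : IsFoundation S) (ρ : Set (StarRep.{u, u} S)) :
    Set.centralizer (cstarOps ρ) = Set.centralizer (measureOps ρ) := by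
  apply Set.Subset.antisymm (Set.centralizer_subset (measureOps_subset_cstarOps ρ))
  intro T hT
  have hcomm : Set.centralizer (Set.range (sumRep ρ).hom) = Set.centralizer (measureOps ρ) :=
    (sumRep ρ).centralizer_range_hom hS
  have hT' : star T ∈ Set.centralizer (measureOps ρ) := by
    rw [← hcomm] at hT ⊢
    exact (sumRep ρ).centralizer_range_hom_star hT
  have himage : productRep ρ '' (tildeFamily '' L S) = measureOps ρ := by
    rw [Set.image_image]
    exact Set.image_congr fun μ hμ => productRep_tildeFamily ρ hμ
  -- By continuity of `productRep ρ`, the image of `CStar S` lies in the norm closure of the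
  -- $*$-algebra generated by `measureOps ρ`, hence in its double $*$-centralizer.
  have hle : (CStar S).map (productRep ρ) ≤ NonUnitalStarSubalgebra.centralizer ℂ
      (NonUnitalStarSubalgebra.centralizer ℂ (measureOps ρ) :
        Set (HilbertSum ρ →L[ℂ] HilbertSum ρ)) := by
    rw [← himage]
    refine le_trans ?_
      (NonUnitalStarSubalgebra.topologicalClosure_adjoin_le_centralizer_centralizer ℂ _)
    rw [← NonUnitalStarAlgHom.map_adjoin]
    exact NonUnitalStarSubalgebra.map_topologicalClosure_le _ (continuous_productRep ρ)
  have hTmem : T ∈ NonUnitalStarSubalgebra.centralizer ℂ (measureOps ρ) := by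
    refine (NonUnitalStarSubalgebra.mem_centralizer_iff ℂ).2 fun b hb => ⟨hT b hb, ?_⟩
    simpa using (congrArg star (hT' b hb)).symm
  intro a ha
  rw [← coe_map_productRep] at ha
  exact (((NonUnitalStarSubalgebra.mem_centralizer_iff ℂ).1 (hle ha) T hTmem).1).symm

/-- If every `π ∈ ρ` is unital, then `π̃_ρ(C*(S))` is nondegenerate. -/
theorem cstarOps_nondegenerate (hS : IsFoundation S) {ρ : Set (StarRep.{u, u} S)}
    (hρ : ∀ π ∈ ρ, π.hom 1 = 1) (ξ : HilbertSum ρ) (h : ∀ a ∈ cstarOps ρ, a ξ = 0) : ξ = 0 := by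
  -- Evaluated at the identity of `S`, where each summand acts as the identity operator.
  have h1 := (sumRep ρ).hom_apply_eq_zero hS (ξ := ξ)
    (fun μ hμ => h _ (measureOps_subset_cstarOps ρ ⟨μ, hμ, rfl⟩)) 1
  ext π
  have h2 : π.1.hom 1 (ξ π) = 0 := congrArg (fun η : HilbertSum ρ => η π) h1
  rwa [hρ π.1 π.2] at h2

theorem bicommutants_eq_WStar (hS : IsFoundation S) {ρ : Set (StarRep.{u, u} S)}
    (hρ : ∀ π ∈ ρ, π.hom 1 = 1) :
    bicommutant (semigroupOps ρ) = bicommutant (measureOps ρ) ∧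
      bicommutant (measureOps ρ) = bicommutant (cstarOps ρ) ∧
      bicommutant (cstarOps ρ) = WStar ρ := by
  refine ⟨bicommutant_congr ((sumRep ρ).centralizer_range_hom hS),
    bicommutant_congr (centralizer_cstarOps hS ρ).symm, ?_⟩
  rw [WStar, ← coe_map_productRep]
  refine bicommutant_eq_wotClosure _ fun ξ h => cstarOps_nondegenerate hS hρ ξ ?_
  rw [← coe_map_productRep]
  exact h

end Universal

end FoundationSemigroup

end

open FoundationSemigroup in
theorem proposition2p1 {S : Type u} [Monoid S] [StarMul S]
    [TopologicalSpace S] [T2Space S] [LocallyCompactSpace S] [ContinuousMul S] [ContinuousStar S]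
    [MeasurableSpace S] [BorelSpace S]
    (hfoundation : IsFoundation S) (hsep : SeparatesPoints S) :
    -- in the direct sum of all irreducible representations
    (bicommutant (semigroupOps (irreducibles S)) = bicommutant (measureOps (irreducibles S)) ∧
      bicommutant (measureOps (irreducibles S)) = bicommutant (cstarOps (irreducibles S)) ∧
      bicommutant (cstarOps (irreducibles S)) = WStar (irreducibles S)) ∧
    -- in the direct sum of all cyclic representations
    (bicommutant (semigroupOps (cyclics S)) = bicommutant (measureOps (cyclics S)) ∧
      bicommutant (measureOps (cyclics S)) = bicommutant (cstarOps (cyclics S)) ∧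
      bicommutant (cstarOps (cyclics S)) = WStar (cyclics S)) :=
  ⟨bicommutants_eq_WStar hfoundation fun _ h => StarRep.IsIrreducible.hom_one h,
    bicommutants_eq_WStar hfoundation fun _ h => StarRep.IsCyclic.hom_one h⟩
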